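/- Let $G$ be a Lie group and $K\le H\le G$ closed subgroups such that $G/K$ is compact and connected; give $G/K$ and $G/H$ their smooth structures as homogeneous spaces and let $\pi\colon G/K\to G/H$, $aK\mapsto aH$, with fibre $\pi^{-1}(eH)=H/K$. Suppose that every $G$-invariant Riemannian metric on $G/K$ is a submersion metric for $H/K\to G/K\to G/H$, i.e. for every such metric $g$ there is a Riemannian metric on $G/H$ for which $\pi$ is a Riemannian submersion. Let $(g_i)_i$ be a family of $G$-invariant Riemannian metrics on $G/K$ (a sequence with $i\to\infty$, a one-parameter family with $i=t\to T$, or more generally a family indexed by a set with a filter along which limits are taken), and suppose that the fibre shrinks to a point: $H/K\subseteq G/K$ with the restriction of the Riemannian distance $d_{g_i}$ converges to a one-point space in the Gromov–Hausdorff sense, i.e. its diameter tends to $0$. Then there are $G$-invariant Riemannian metrics $b_i$ on $G/H$ for which $\pi\colon(G/K,g_i)\to(G/H,b_i)$ is a Riemannian submersion, such that $G/K$ converges to $G/H$ in the Gromov–Hausdorff sense: $$d_{GH}\big((G/K,d_{g_i}),(G/H,d_{b_i})\big)\to 0,$$ and, whenever the metrics $b_i$ converge pointwise to a Riemannian metric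 $b$ on $G/H$ (for example if all $b_i$ are equal to $b$), $$d_{GH}\big((G/K,d_{g_i}),(G/H,d_{b})\big)\to 0.$$ Here $d_{GH}(A,B)$ is the infimum of all $\epsilon$ for which there is a set $S\subseteq A\times B$ that projects onto $A$ and onto $B$ and satisfies $|d_A(p_1,q_1)-d_B(p_2,q_2)|<\epsilon$ for all $(p_1,p_2),(q_1,q_2)\in S$ (and $\infty$ if there is no such $\epsilon$). -/

import Mathlib

open Bundle Filter Topology
open scoped Manifold ContDiff ENNReal

noncomputable section

/-! ### The distance between metric spaces, in terms of their distance functions -/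

/-- `S ⊆ A × B` is an `ε`-approximation between `(A, dA)` and `(B, dB)`: it projects onto `A` and
onto `B`, and distances of corresponding points differ by less than `ε`. -/
structure IsApproximation {A B : Type*} (dA : A → A → ℝ) (dB : B → B → ℝ) (ε : ℝ)
    (S : Set (A × B)) : Prop where
  fst_onto : ∀ a, ∃ b, (a, b) ∈ S
  snd_onto : ∀ b, ∃ a, (a, b) ∈ S
  dist_lt : ∀ p ∈ S, ∀ q ∈ S, |dA p.1 q.1 - dB p.2 q.2| < ε

/-- The Gromov–Hausdorff distance: the infimum of all `ε` for which there is an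
`ε`-approximation, and `∞` if there is none. -/
def gromovHausdorffDist {A B : Type*} (dA : A → A → ℝ) (dB : B → B → ℝ) : ℝ≥0∞ :=
  ⨅ (ε : ℝ) (_ : ∃ S : Set (A × B), IsApproximation dA dB ε S), ENNReal.ofReal ε

/-! ### Riemannian metrics and Riemannian submersions -/

/-- Smooth Riemannian metrics on a manifold `M` modelled on `E`. -/
abbrev RiemMetric (E : Type*) [NormedAddCommGroup E] [NormedSpace ℝ E]
    (M : Type*) [TopologicalSpace M] [ChartedSpace E M] [IsManifold 𝓘(ℝ, E) ∞ M] :=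
  ContMDiffRiemannianMetric 𝓘(ℝ, E) ∞ E (fun x : M ↦ TangentSpace 𝓘(ℝ, E) x)

section Riemannian

variable {E : Type*} [NormedAddCommGroup E] [NormedSpace ℝ E]
  {M : Type*} [TopologicalSpace M] [ChartedSpace E M] [IsManifold 𝓘(ℝ, E) ∞ M]
  {F : Type*} [NormedAddCommGroup F] [NormedSpace ℝ F]
  {N : Type*} [TopologicalSpace N] [ChartedSpace F N] [IsManifold 𝓘(ℝ, F) ∞ N]

/-- The Riemannian distance of `g`: the infimum of the `g`-lengths of the `C¹` paths between two
points. It is used only on connected manifolds, where this infimum is finite. -/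
def RiemMetric.rdist (g : RiemMetric E M) (x y : M) : ℝ :=
  letI : RiemannianBundle (fun x : M ↦ TangentSpace 𝓘(ℝ, E) x) := ⟨g.toRiemannianMetric⟩
  (Manifold.riemannianEDist 𝓘(ℝ, E) x y).toReal

/-- `g` is invariant under the action of `G` on `M`: every `a : G` acts by isometries. -/
def RiemMetric.IsInvariant (G : Type*) [SMul G M] (g : RiemMetric E M) : Prop :=
  ∀ (a : G) (x : M) (v w : TangentSpace 𝓘(ℝ, E) x),
    g.inner (a • x)
      (mfderiv 𝓘(ℝ, E) 𝓘(ℝ, E) (fun y : M ↦ a • y) x v)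
      (mfderiv 𝓘(ℝ, E) 𝓘(ℝ, E) (fun y : M ↦ a • y) x w) = g.inner x v w

/-- `v` is horizontal for `f` at `x`: it is `g`-orthogonal to the vertical space `ker (df_x)`. -/
def RiemMetric.IsHorizontal (g : RiemMetric E M) (f : M → N) (x : M)
    (v : TangentSpace 𝓘(ℝ, E) x) : Prop :=
  ∀ u : TangentSpace 𝓘(ℝ, E) x, mfderiv 𝓘(ℝ, E) 𝓘(ℝ, F) f x u = 0 → g.inner x u v = 0

/-- `f : (M, g) → (N, h)` is a Riemannian submersion: a smooth submersion whose differential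
preserves inner products of horizontal vectors. -/
structure IsRiemannianSubmersion (g : RiemMetric E M) (h : RiemMetric F N) (f : M → N) :
    Prop where
  submersion : Manifold.IsSubmersion 𝓘(ℝ, E) 𝓘(ℝ, F) ∞ f
  isometry : ∀ (x : M) (v w : TangentSpace 𝓘(ℝ, E) x),
    g.IsHorizontal (F := F) f x v → g.IsHorizontal (F := F) f x w →
      h.inner (f x) (mfderiv 𝓘(ℝ, E) 𝓘(ℝ, F) f x v) (mfderiv 𝓘(ℝ, E) 𝓘(ℝ, F) f x w)
        = g.inner x v w

end Riemannian

/-! ### Homogeneous spaces -/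

/-- The manifold structure carried by `G ⧸ K` is the one of the homogeneous space, that is, the
(unique) smooth structure for which the quotient map `G → G ⧸ K` is a smooth submersion. -/
def IsHomogeneousManifold {E : Type*} [NormedAddCommGroup E] [NormedSpace ℝ E]
    {G : Type*} [TopologicalSpace G] [ChartedSpace E G] [Group G] (K : Subgroup G)
    (EK : Type*) [NormedAddCommGroup EK] [NormedSpace ℝ EK] [ChartedSpace EK (G ⧸ K)] : Prop :=
  Manifold.IsSubmersion 𝓘(ℝ, E) 𝓘(ℝ, EK) ∞ (QuotientGroup.mk : G → G ⧸ K)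

/-- The projection `G ⧸ K → G ⧸ H`, `aK ↦ aH`. -/
abbrev cosetProj {G : Type*} [Group G] {K H : Subgroup G} (hKH : K ≤ H) : G ⧸ K → G ⧸ H :=
  Subgroup.quotientMapOfLE hKH

/-- The fibre `H/K` of `G ⧸ K → G ⧸ H` over the base point `eH`, as a subset of `G ⧸ K`. -/
def cosetFibre {G : Type*} [Group G] {K H : Subgroup G} (hKH : K ≤ H) : Set (G ⧸ K) :=
  {x | cosetProj hKH x = ((1 : G) : G ⧸ H)}

end

/-!
A curve in the base of a Riemannian submersion with compact total space lifts, through any point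
over its start, up to an arbitrarily small error: small steps are made along curves that start
horizontally, hence are not much longer than the part of the base curve below them, and compactness
carries the endpoints of the steps to the end of the curve. This is weaker than a horizontal lift of
the curve but needs no differential equation. It yields
`b(f p, f q) ≤ g(p, q) ≤ b(f p, f q) + δ` for the two distances, where `δ` bounds the diameters of
the fibres. The group moves every fibre isometrically onto the fibre over the base point, so
`δ → 0`, and the graph of `f` shows the Gromov–Hausdorff convergence.

If the induced metrics converge pointwise to `b'`, then `b'` is invariant as well, so that the
comparison `C⁻¹ b' ≤ bᵢ ≤ C b'` on a single tangent space, which is a matter of finite dimension,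
holds on all of them. Thus the distances converge uniformly.
-/

open MeasureTheory Set

/-! ### Riemannian distances and speeds -/

section Distance

lemma lintegral_Icc_ofReal_eq {k : ℝ → ℝ} {a b : ℝ} (hab : a ≤ b) (hk : ContinuousOn k (Icc a b))
    (hk0 : ∀ t ∈ Icc a b, 0 ≤ k t) :
    ∫⁻ t in Icc a b, ENNReal.ofReal (k t) = ENNReal.ofReal (∫ t in a..b, k t) := by
  rw [intervalIntegral.integral_of_le hab, ← integral_Icc_eq_integral_Ioc,
    ofReal_integral_eq_lintegral_ofReal hk.integrableOn_Icc
      ((ae_restrict_mem measurableSet_Icc).mono hk0)]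

variable {E : Type*} [NormedAddCommGroup E] [NormedSpace ℝ E]
  {M : Type*} [TopologicalSpace M] [ChartedSpace E M]
  {F : Type*} [NormedAddCommGroup F] [NormedSpace ℝ F]
  {N : Type*} [TopologicalSpace N] [ChartedSpace F N]

/-- The velocity of the curve `γ` at time `t`, with junk value `0` where `γ` is not
differentiable. -/
noncomputable def velocity (γ : ℝ → M) (t : ℝ) : TangentSpace 𝓘(ℝ, E) (γ t) :=
  mfderiv 𝓘(ℝ, ℝ) 𝓘(ℝ, E) γ t (1 : ℝ)

lemma velocity_comp {f : M → N} {γ : ℝ → M} {t : ℝ}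
    (hf : MDifferentiableAt 𝓘(ℝ, E) 𝓘(ℝ, F) f (γ t))
    (hγ : MDifferentiableAt 𝓘(ℝ, ℝ) 𝓘(ℝ, E) γ t) :
    velocity (f ∘ γ) t = mfderiv 𝓘(ℝ, E) 𝓘(ℝ, F) f (γ t) (velocity γ t) :=
  DFunLike.congr_fun (mfderiv_comp t hf hγ) (1 : ℝ)

variable [IsManifold 𝓘(ℝ, E) ∞ M] [IsManifold 𝓘(ℝ, F) ∞ N]

namespace RiemMetric

/-- The inner products of `g` on the tangent spaces, as the structure through which the library
defines lengths of curves and the Riemannian distance. -/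
noncomputable abbrev riemannianBundle (g : RiemMetric E M) :
    RiemannianBundle (fun x : M ↦ TangentSpace 𝓘(ℝ, E) x) :=
  ⟨g.toRiemannianMetric⟩

/-- The Riemannian distance of `g` before truncation to a real number, so that it is infinite
between points which no `C¹` path connects. -/
noncomputable def edist (g : RiemMetric E M) (x y : M) : ℝ≥0∞ :=
  letI := g.riemannianBundle
  Manifold.riemannianEDist 𝓘(ℝ, E) x y

/-- The `g`-norm of the velocity of the curve `γ` at time `t`. -/
noncomputable def speed (g : RiemMetric E M) (γ : ℝ → M) (t : ℝ) : ℝ :=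
  √(g.inner (γ t) (velocity γ t) (velocity γ t))

lemma isContinuousRiemannianBundle (g : RiemMetric E M) :
    letI := g.riemannianBundle
    IsContinuousRiemannianBundle E (fun x : M ↦ TangentSpace 𝓘(ℝ, E) x) :=
  let := g.riemannianBundle
  ⟨g.inner, g.contMDiff.continuous, fun _ _ _ ↦ rfl⟩

lemma inner_congr (g : RiemMetric E M) {x y : M} (h : x = y) {v v' w w' : E} (hv : v = v')
    (hw : w = w') : g.inner x v w = g.inner y v' w' := by
  subst h hv hw
  rfl

lemma inner_self_nonneg (g : RiemMetric E M) (x : M) (v : TangentSpace 𝓘(ℝ, E) x) :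
    0 ≤ g.inner x v v := by
  rcases eq_or_ne v 0 with rfl | hv
  · simp
  · exact (g.pos x v hv).le

variable (g : RiemMetric E M)

lemma speed_nonneg (γ : ℝ → M) (t : ℝ) : 0 ≤ g.speed γ t := Real.sqrt_nonneg _

lemma rdist_nonneg (x y : M) : 0 ≤ g.rdist x y := ENNReal.toReal_nonneg

lemma edist_self (x : M) : g.edist x x = 0 :=
  let := g.riemannianBundle
  Manifold.riemannianEDist_self

lemma edist_comm (x y : M) : g.edist x y = g.edist y x :=
  let := g.riemannianBundle
  Manifold.riemannianEDist_comm

lemma edist_triangle (x y z : M) : g.edist x z ≤ g.edist x y + g.edist y z :=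
  let := g.riemannianBundle
  Manifold.riemannianEDist_triangle

lemma eventually_edist_lt (x : M) {c : ℝ≥0∞} (hc : 0 < c) : ∀ᶠ y in 𝓝 x, g.edist x y < c :=
  let := g.riemannianBundle
  have := g.isContinuousRiemannianBundle
  eventually_riemannianEDist_lt 𝓘(ℝ, E) x hc

lemma edist_ne_top [PreconnectedSpace M] (x y : M) : g.edist x y ≠ ⊤ := by
  refine PreconnectedSpace.induction₂' (fun x y ↦ g.edist x y ≠ ⊤) (fun x ↦ ?_)
    ⟨fun x y z hxy hyz ↦ ?_⟩ x y
  · filter_upwards [g.eventually_edist_lt x ENNReal.zero_lt_top] with y hy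
    exact ⟨hy.ne, g.edist_comm x y ▸ hy.ne⟩
  · exact ne_top_of_le_ne_top (ENNReal.add_ne_top.2 ⟨hxy, hyz⟩) (g.edist_triangle x y z)

@[simp] lemma rdist_self (x : M) : g.rdist x x = 0 :=
  congrArg ENNReal.toReal (g.edist_self x)

lemma rdist_comm (x y : M) : g.rdist x y = g.rdist y x :=
  congrArg ENNReal.toReal (g.edist_comm x y)

lemma rdist_triangle [PreconnectedSpace M] (x y z : M) :
    g.rdist x z ≤ g.rdist x y + g.rdist y z := by
  have hxyz := ENNReal.toReal_mono
    (ENNReal.add_ne_top.2 ⟨g.edist_ne_top x y, g.edist_ne_top y z⟩) (g.edist_triangle x y z)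
  rwa [ENNReal.toReal_add (g.edist_ne_top x y) (g.edist_ne_top y z)] at hxyz

lemma eventually_rdist_lt (x : M) {ε : ℝ} (hε : 0 < ε) : ∀ᶠ y in 𝓝 x, g.rdist x y < ε := by
  filter_upwards [g.eventually_edist_lt x (ENNReal.ofReal_pos.2 hε)] with y hy
  exact (ENNReal.lt_ofReal_iff_toReal_lt hy.ne_top).1 hy

lemma continuous_rdist [PreconnectedSpace M] : Continuous fun p : M × M ↦ g.rdist p.1 p.2 := by
  refine continuous_iff_continuousAt.2 fun ⟨x, y⟩ ↦ Metric.tendsto_nhds.2 fun ε hε ↦ ?_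
  filter_upwards [(g.eventually_rdist_lt x (half_pos hε)).prod_nhds
    (g.eventually_rdist_lt y (half_pos hε))] with ⟨x', y'⟩ ⟨hx, hy⟩
  rw [Real.dist_eq, abs_sub_lt_iff]
  constructor
  · linarith [g.rdist_triangle x' x y', g.rdist_triangle x y y', g.rdist_comm x' x]
  · linarith [g.rdist_triangle x x' y, g.rdist_triangle x' y' y, g.rdist_comm y' y]

lemma exists_forall_rdist_le [CompactSpace M] [PreconnectedSpace M] :
    ∃ D, 0 ≤ D ∧ ∀ x y, g.rdist x y ≤ D := by
  obtain ⟨D, hD⟩ := (isCompact_range g.continuous_rdist).bddAbove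
  exact ⟨max D 0, le_max_right _ _, fun x y ↦ (hD ⟨(x, y), rfl⟩).trans (le_max_left _ _)⟩

lemma pathELength_eq_lintegral_speed (γ : ℝ → M) (a b : ℝ) :
    letI := g.riemannianBundle
    Manifold.pathELength 𝓘(ℝ, E) γ a b = ∫⁻ t in Icc a b, ENNReal.ofReal (g.speed γ t) := by
  let := g.riemannianBundle
  rw [Manifold.pathELength_eq_lintegral_mfderiv_Icc]
  refine lintegral_congr fun t ↦ ?_
  rw [← ofReal_norm, norm_eq_sqrt_real_inner]
  rfl

variable {g}

lemma rdist_le_integral_of_speed_le {γ : ℝ → M} {k : ℝ → ℝ} {a b : ℝ} (hab : a ≤ b)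
    (hγ : ContMDiffOn 𝓘(ℝ, ℝ) 𝓘(ℝ, E) 1 γ (Icc a b)) (hk : ContinuousOn k (Icc a b))
    (hγk : ∀ t ∈ Icc a b, g.speed γ t ≤ k t) :
    g.rdist (γ a) (γ b) ≤ ∫ t in a..b, k t := by
  let := g.riemannianBundle
  have hk0 : ∀ t ∈ Icc a b, 0 ≤ k t := fun t ht ↦ (g.speed_nonneg γ t).trans (hγk t ht)
  refine ENNReal.toReal_le_of_le_ofReal (intervalIntegral.integral_nonneg hab hk0) ?_
  calc g.edist (γ a) (γ b)
      ≤ Manifold.pathELength 𝓘(ℝ, E) γ a b :=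
        Manifold.riemannianEDist_le_pathELength hγ rfl rfl hab
    _ = ∫⁻ t in Icc a b, ENNReal.ofReal (g.speed γ t) := g.pathELength_eq_lintegral_speed γ a b
    _ ≤ ∫⁻ t in Icc a b, ENNReal.ofReal (k t) :=
        setLIntegral_mono' measurableSet_Icc fun t ht ↦ ENNReal.ofReal_le_ofReal (hγk t ht)
    _ = ENNReal.ofReal (∫ t in a..b, k t) := lintegral_Icc_ofReal_eq hab hk hk0

lemma continuousOn_speed {γ : ℝ → M} {U : Set ℝ} (hU : IsOpen U)
    (hγ : ContMDiffOn 𝓘(ℝ, ℝ) 𝓘(ℝ, E) 1 γ U) : ContinuousOn (g.speed γ) U := by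
  let := g.riemannianBundle
  have := g.isContinuousRiemannianBundle
  have hγ' : ContinuousOn (fun t : ℝ ↦ (⟨γ t, velocity γ t⟩ :
      TotalSpace E (fun x : M ↦ TangentSpace 𝓘(ℝ, E) x))) U := by
    have hunit : Continuous fun t : ℝ ↦
        (tangentBundleModelSpaceHomeomorph 𝓘(ℝ, ℝ)).symm (t, (1 : ℝ)) := by fun_prop
    refine ((hγ.continuousOn_tangentMapWithin le_rfl hU.uniqueMDiffOn).comp
      hunit.continuousOn fun t ht ↦ ht).congr fun t ht ↦ ?_
    rw [velocity, ← mfderivWithin_of_isOpen hU ht]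
    rfl
  exact (hγ'.inner_bundle hγ').sqrt

lemma continuousAt_speed {γ : ℝ → M} {t : ℝ} (hγ : ContMDiffAt 𝓘(ℝ, ℝ) 𝓘(ℝ, E) 1 γ t) :
    ContinuousAt (g.speed γ) t := by
  obtain ⟨U, hU, hγU⟩ := (contMDiffAt_iff_contMDiffOn_nhds (by simp)).1 hγ
  exact (continuousOn_speed isOpen_interior (hγU.mono interior_subset)).continuousAt
    (interior_mem_nhds.2 hU)

lemma continuous_speed {γ : ℝ → M} (hγ : ContMDiff 𝓘(ℝ, ℝ) 𝓘(ℝ, E) 1 γ) :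
    Continuous (g.speed γ) :=
  continuous_iff_continuousAt.2 fun t ↦ continuousAt_speed (hγ t)

lemma exists_curve_integral_speed_lt [PreconnectedSpace M] {x y : M} {r : ℝ}
    (hr : g.rdist x y < r) :
    ∃ γ : ℝ → M, γ 0 = x ∧ γ 1 = y ∧ ContMDiff 𝓘(ℝ, ℝ) 𝓘(ℝ, E) 1 γ ∧
      ∫ t in (0 : ℝ)..1, g.speed γ t < r := by
  let := g.riemannianBundle
  have hr' : g.edist x y < ENNReal.ofReal r :=
    (ENNReal.lt_ofReal_iff_toReal_lt (g.edist_ne_top x y)).2 hr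
  obtain ⟨γ, h0, h1, hγ, hlen, -⟩ :=
    Manifold.exists_lt_locally_constant_of_riemannianEDist_lt hr' zero_lt_one
  rw [g.pathELength_eq_lintegral_speed, lintegral_Icc_ofReal_eq zero_le_one
    (continuous_speed hγ).continuousOn fun t _ ↦ g.speed_nonneg γ t] at hlen
  exact ⟨γ, h0, h1, hγ, (ENNReal.ofReal_lt_ofReal_iff ((g.rdist_nonneg x y).trans_lt hr)).1 hlen⟩

lemma speed_comp_le {h : RiemMetric F N} {f : M → N} (hf : MDifferentiable 𝓘(ℝ, E) 𝓘(ℝ, F) f)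
    {C : ℝ} (hC : 0 ≤ C)
    (hfC : ∀ (x : M) (v : TangentSpace 𝓘(ℝ, E) x),
      h.inner (f x) (mfderiv 𝓘(ℝ, E) 𝓘(ℝ, F) f x v) (mfderiv 𝓘(ℝ, E) 𝓘(ℝ, F) f x v)
        ≤ C ^ 2 * g.inner x v v)
    {γ : ℝ → M} {t : ℝ} (hγ : MDifferentiableAt 𝓘(ℝ, ℝ) 𝓘(ℝ, E) γ t) :
    h.speed (f ∘ γ) t ≤ C * g.speed γ t := by
  rw [speed, speed, velocity_comp (hf (γ t)) hγ, ← Real.sqrt_sq hC, ← Real.sqrt_mul (sq_nonneg C)]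
  exact Real.sqrt_le_sqrt (hfC _ _)

lemma rdist_map_le [PreconnectedSpace M] {h : RiemMetric F N} {f : M → N}
    (hf : ContMDiff 𝓘(ℝ, E) 𝓘(ℝ, F) 1 f) {C : ℝ} (hC : 0 ≤ C)
    (hfC : ∀ (x : M) (v : TangentSpace 𝓘(ℝ, E) x),
      h.inner (f x) (mfderiv 𝓘(ℝ, E) 𝓘(ℝ, F) f x v) (mfderiv 𝓘(ℝ, E) 𝓘(ℝ, F) f x v)
        ≤ C ^ 2 * g.inner x v v) (x y : M) :
    h.rdist (f x) (f y) ≤ C * g.rdist x y := by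
  have hlt : ∀ r > g.rdist x y, h.rdist (f x) (f y) ≤ C * r := by
    intro r hr
    obtain ⟨γ, rfl, rfl, hγ, hlen⟩ := exists_curve_integral_speed_lt hr
    calc h.rdist (f (γ 0)) (f (γ 1))
        ≤ ∫ t in (0 : ℝ)..1, C * g.speed γ t :=
          rdist_le_integral_of_speed_le (γ := f ∘ γ) zero_le_one (hf.comp hγ).contMDiffOn
            (continuous_const.mul (continuous_speed hγ)).continuousOn fun t _ ↦
              speed_comp_le (hf.mdifferentiable one_ne_zero) hC hfC
                (hγ.mdifferentiable one_ne_zero t)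
      _ = C * ∫ t in (0 : ℝ)..1, g.speed γ t := intervalIntegral.integral_const_mul _ _
      _ ≤ C * r := by gcongr
  have hlim : Tendsto (fun r ↦ C * r) (𝓝[>] g.rdist x y) (𝓝 (C * g.rdist x y)) :=
    (continuous_const_mul C).continuousWithinAt
  exact ge_of_tendsto hlim (eventually_mem_nhdsWithin.mono hlt)

end RiemMetric

end Distance

/-! ### Local structure of submersions -/

section Submersion

open Manifold

variable {𝕜 : Type*} [NontriviallyNormedField 𝕜]
  {E : Type*} [NormedAddCommGroup E] [NormedSpace 𝕜 E]
  {M : Type*} [TopologicalSpace M] [ChartedSpace E M]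
  {F : Type*} [NormedAddCommGroup F] [NormedSpace 𝕜 F]
  {N : Type*} [TopologicalSpace N] [ChartedSpace F N]
  {P' : Type*} [NormedAddCommGroup P'] [NormedSpace 𝕜 P']
  {P : Type*} [TopologicalSpace P] [ChartedSpace P' P]
  {n : ℕ∞ω} {f : M → N} {x : M}

lemma codChart_apply_of_isSubmersionAt (h : IsSubmersionAt 𝓘(𝕜, E) 𝓘(𝕜, F) n f x) {p : M}
    (hp : p ∈ h.domChart.source) : h.codChart (f p) = (h.equiv (h.domChart p)).1 := by
  have hp' : h.domChart p ∈ (h.domChart.extend 𝓘(𝕜, E)).target := by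
    simpa using h.domChart.map_source hp
  simpa [h.domChart.left_inv hp] using h.writtenInCharts hp'

lemma exists_local_product_of_isSubmersionAt (h : IsSubmersionAt 𝓘(𝕜, E) 𝓘(𝕜, F) n f x) :
    ∃ (ζ : M → h.complement) (τ : N × h.complement → M),
      ContMDiffAt 𝓘(𝕜, E) 𝓘(𝕜, h.complement) n ζ x ∧
      ContMDiffAt (𝓘(𝕜, F).prod 𝓘(𝕜, h.complement)) 𝓘(𝕜, E) n τ (f x, ζ x) ∧
      (∀ᶠ p in 𝓝 x, τ (f p, ζ p) = p) ∧
      ∀ᶠ q in 𝓝 (f x, ζ x), f (τ q) = q.1 ∧ ζ (τ q) = q.2 := by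
  let ζ : M → h.complement := fun p ↦ (h.equiv (h.domChart p)).2
  let κ : N × h.complement → E := fun q ↦ h.equiv.symm (h.codChart q.1, q.2)
  have hκ_apply : ∀ p ∈ h.domChart.source, κ (f p, ζ p) = h.domChart p := fun p hp ↦ by
    simp [κ, ζ, codChart_apply_of_isSubmersionAt h hp]
  have hκ : ContMDiffAt (𝓘(𝕜, F).prod 𝓘(𝕜, h.complement)) 𝓘(𝕜, E) n κ (f x, ζ x) :=
    h.equiv.symm.contDiff.contMDiff.contMDiffAt.comp (f x, ζ x)
      (((contMDiffAt_of_mem_maximalAtlas h.codChart_mem_maximalAtlas h.mem_codChart_source).comp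
        (f x, ζ x) contMDiffAt_fst).prodMk_space contMDiffAt_snd)
  have hκx : κ (f x, ζ x) ∈ h.domChart.target :=
    hκ_apply x h.mem_domChart_source ▸ h.domChart.map_source h.mem_domChart_source
  refine ⟨ζ, h.domChart.symm ∘ κ, ?_, ?_, ?_, ?_⟩
  · exact (h.equiv.contDiff.snd.contMDiff.contMDiffAt).comp x
      (contMDiffAt_of_mem_maximalAtlas h.domChart_mem_maximalAtlas h.mem_domChart_source)
  · exact (contMDiffAt_symm_of_mem_maximalAtlas h.domChart_mem_maximalAtlas hκx).comp _ hκ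
  · filter_upwards [h.domChart.open_source.mem_nhds h.mem_domChart_source] with p hp
    rw [Function.comp_apply, hκ_apply p hp, h.domChart.left_inv hp]
  · filter_upwards [hκ.continuousAt.preimage_mem_nhds (h.domChart.open_target.mem_nhds hκx),
      continuousAt_fst.preimage_mem_nhds (h.codChart.open_source.mem_nhds h.mem_codChart_source)]
      with q hqE hqN
    have hq : h.domChart.symm (κ q) ∈ h.domChart.source := h.domChart.map_target hqE
    have hκq : h.domChart (h.domChart.symm (κ q)) = κ q := h.domChart.right_inv hqE
    refine ⟨h.codChart.injOn (h.source_subset_preimage_source hq) hqN ?_, ?_⟩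
    · simp [codChart_apply_of_isSubmersionAt h hq, hκq, κ]
    · simp [ζ, hκq, κ]

lemma exists_section_of_isSubmersionAt (h : IsSubmersionAt 𝓘(𝕜, E) 𝓘(𝕜, F) n f x) :
    ∃ s : N → M, s (f x) = x ∧ ContMDiffAt 𝓘(𝕜, F) 𝓘(𝕜, E) n s (f x) ∧
      ∀ᶠ y in 𝓝 (f x), f (s y) = y := by
  obtain ⟨ζ, τ, -, hτ, hτx, hτf⟩ := exists_local_product_of_isSubmersionAt h
  refine ⟨fun y ↦ τ (y, ζ x), hτx.self_of_nhds,
    hτ.comp (f x) (contMDiffAt_id.prodMk contMDiffAt_const), ?_⟩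
  filter_upwards [(Continuous.prodMk_left (ζ x)).continuousAt.eventually hτf] with y hy
  exact hy.1

lemma mfderiv_surjective_of_isSubmersionAt (hn : n ≠ 0)
    (h : IsSubmersionAt 𝓘(𝕜, E) 𝓘(𝕜, F) n f x) :
    Function.Surjective (mfderiv 𝓘(𝕜, E) 𝓘(𝕜, F) f x) := by
  obtain ⟨s, hsx, hs, hfs⟩ := exists_section_of_isSubmersionAt h
  have hf : MDifferentiableAt 𝓘(𝕜, E) 𝓘(𝕜, F) f (s (f x)) :=
    hsx.symm ▸ h.contMDiffAt.mdifferentiableAt hn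
  have hid := (show f ∘ s =ᶠ[𝓝 (f x)] id from hfs).mfderiv_eq (I := 𝓘(𝕜, F)) (I' := 𝓘(𝕜, F))
  rw [mfderiv_comp (f x) hf (hs.mdifferentiableAt hn), mfderiv_id, hsx] at hid
  exact fun v ↦ ⟨mfderiv 𝓘(𝕜, F) 𝓘(𝕜, E) s (f x) v, DFunLike.congr_fun hid v⟩

lemma contMDiff_of_comp_of_isSubmersion (hf : IsSubmersion 𝓘(𝕜, E) 𝓘(𝕜, F) n f)
    (hsurj : Function.Surjective f) {k : N → P}
    (hk : ContMDiff 𝓘(𝕜, E) 𝓘(𝕜, P') n (k ∘ f)) : ContMDiff 𝓘(𝕜, F) 𝓘(𝕜, P') n k := by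
  intro y
  obtain ⟨x, rfl⟩ := hsurj y
  obtain ⟨s, -, hs, hfs⟩ := exists_section_of_isSubmersionAt (hf.isSubmersionAt x)
  refine (hk.contMDiffAt.comp (f x) hs).congr_of_eventuallyEq ?_
  filter_upwards [hfs] with z hz
  exact congrArg k hz.symm

end Submersion

section CurveLift

open Manifold

variable {E : Type*} [NormedAddCommGroup E] [NormedSpace ℝ E]
  {M : Type*} [TopologicalSpace M] [ChartedSpace E M]
  {F : Type*} [NormedAddCommGroup F] [NormedSpace ℝ F]
  {N : Type*} [TopologicalSpace N] [ChartedSpace F N] {f : M → N} {x : M}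

lemma exists_curve_lift_of_isSubmersionAt {n : ℕ∞ω} (hn : 1 ≤ n)
    (h : IsSubmersionAt 𝓘(ℝ, E) 𝓘(ℝ, F) n f x)
    {γ : ℝ → N} {t : ℝ} (hγ : ContMDiffAt 𝓘(ℝ, ℝ) 𝓘(ℝ, F) 1 γ t) (hxt : f x = γ t)
    (u : TangentSpace 𝓘(ℝ, E) x) (hu : (mfderiv 𝓘(ℝ, E) 𝓘(ℝ, F) f x u : F) = velocity γ t) :
    ∃ c : ℝ → M, c t = x ∧ ContMDiffAt 𝓘(ℝ, ℝ) 𝓘(ℝ, E) 1 c t ∧ (∀ᶠ s in 𝓝 t, f (c s) = γ s) ∧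
      (velocity c t : E) = u := by
  obtain ⟨ζ, τ, hζ, hτ, hτx, hτf⟩ := exists_local_product_of_isSubmersionAt h
  have hn0 : n ≠ 0 := (zero_lt_one.trans_le hn).ne'
  let w : h.complement := mfderiv 𝓘(ℝ, E) 𝓘(ℝ, h.complement) ζ x u
  let β : ℝ → h.complement := fun s ↦ ζ x + (s - t) • w
  have hβ : HasDerivAt β w t :=
    ((((hasDerivAt_id t).sub_const t).smul_const w).const_add (ζ x)).congr_deriv (one_smul ℝ w)
  have hβsmooth : ContMDiffAt 𝓘(ℝ, ℝ) 𝓘(ℝ, h.complement) 1 β t :=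
    (show ContDiff ℝ 1 β by fun_prop).contMDiff.contMDiffAt
  have hstart : (γ t, β t) = (f x, ζ x) := by simp [β, hxt]
  have hpair : ContMDiffAt 𝓘(ℝ, ℝ) (𝓘(ℝ, F).prod 𝓘(ℝ, h.complement)) 1
      (fun s ↦ (γ s, β s)) t := hγ.prodMk hβsmooth
  let T : F × h.complement →L[ℝ] E :=
    mfderiv (𝓘(ℝ, F).prod 𝓘(ℝ, h.complement)) 𝓘(ℝ, E) τ (f x, ζ x)
  have hT : ∀ q, q = (f x, ζ x) →
      HasMFDerivAt (𝓘(ℝ, F).prod 𝓘(ℝ, h.complement)) 𝓘(ℝ, E) τ q T := by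
    rintro _ rfl
    exact (hτ.mdifferentiableAt hn0).hasMFDerivAt
  refine ⟨fun s ↦ τ (γ s, β s), ?_, ?_, ?_, ?_⟩
  · exact (congrArg τ hstart).trans hτx.self_of_nhds
  · exact ContMDiffAt.comp t (hstart ▸ hτ.of_le hn) hpair
  · have hpair_tendsto : Tendsto (fun s ↦ (γ s, β s)) (𝓝 t) (𝓝 (f x, ζ x)) :=
      hstart ▸ hpair.continuousAt
    exact (hpair_tendsto.eventually hτf).mono fun s hs ↦ hs.1
  · have hTu : T (mfderiv 𝓘(ℝ, E) 𝓘(ℝ, F) f x u, w) = u := by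
      have hid := (hT _ rfl).comp x ((h.contMDiffAt.mdifferentiableAt hn0).hasMFDerivAt.prodMk
        (hζ.mdifferentiableAt hn0).hasMFDerivAt)
      have hid' := hasMFDerivAt_unique (hid.congr_of_eventuallyEq (EventuallyEq.symm hτx))
        (hasMFDerivAt_id x)
      exact DFunLike.congr_fun hid' u
    have hc := (hT _ hstart).comp t
      ((hγ.mdifferentiableAt one_ne_zero).hasMFDerivAt.prodMk hβ.hasFDerivAt.hasMFDerivAt)
    have hvel : (velocity (fun s ↦ τ (γ s, β s)) t : E) = T ((velocity γ t : F), (1 : ℝ) • w) :=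
      DFunLike.congr_fun hc.mfderiv (1 : ℝ)
    rw [one_smul, ← hu] at hvel
    exact hvel.trans hTu

end CurveLift

/-! ### Riemannian submersions -/

section RiemannianSubmersion

variable {E : Type*} [NormedAddCommGroup E] [NormedSpace ℝ E]
  {M : Type*} [TopologicalSpace M] [ChartedSpace E M] [IsManifold 𝓘(ℝ, E) ∞ M]
  {F : Type*} [NormedAddCommGroup F] [NormedSpace ℝ F]
  {N : Type*} [TopologicalSpace N] [ChartedSpace F N]

lemma IsRiemannianSubmersion.contMDiff [IsManifold 𝓘(ℝ, F) ∞ N] {g : RiemMetric E M}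
    {b : RiemMetric F N} {f : M → N} (h : IsRiemannianSubmersion g b f) :
    ContMDiff 𝓘(ℝ, E) 𝓘(ℝ, F) ∞ f :=
  h.submersion.contMDiff

variable [FiniteDimensional ℝ E]

lemma RiemMetric.exists_isHorizontal (g : RiemMetric E M) (f : M → N) (x : M)
    (v : TangentSpace 𝓘(ℝ, E) x) :
    ∃ w : TangentSpace 𝓘(ℝ, E) x, g.IsHorizontal (F := F) f x w ∧
      mfderiv 𝓘(ℝ, E) 𝓘(ℝ, F) f x w = mfderiv 𝓘(ℝ, E) 𝓘(ℝ, F) f x v := by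
  let := g.riemannianBundle
  let V : Submodule ℝ (TangentSpace 𝓘(ℝ, E) x) :=
    LinearMap.ker (mfderiv 𝓘(ℝ, E) 𝓘(ℝ, F) f x).toLinearMap
  have : FiniteDimensional ℝ V :=
    have : FiniteDimensional ℝ (TangentSpace 𝓘(ℝ, E) x) := inferInstanceAs (FiniteDimensional ℝ E)
    inferInstance
  have : CompleteSpace V := FiniteDimensional.complete ℝ V
  obtain ⟨u, hu, w, hw, rfl⟩ := V.exists_add_mem_mem_orthogonal v
  refine ⟨w, fun u' hu' ↦ (Submodule.mem_orthogonal V w).1 hw u' (LinearMap.mem_ker.2 hu'), ?_⟩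
  have hu0 : mfderiv 𝓘(ℝ, E) 𝓘(ℝ, F) f x u = 0 := LinearMap.mem_ker.1 hu
  rw [map_add, hu0, zero_add]

variable [IsManifold 𝓘(ℝ, F) ∞ N]

namespace IsRiemannianSubmersion

variable {g : RiemMetric E M} {b : RiemMetric F N} {f : M → N}

lemma exists_isHorizontal_lift (h : IsRiemannianSubmersion g b f) (x : M)
    (v : TangentSpace 𝓘(ℝ, F) (f x)) :
    ∃ w : TangentSpace 𝓘(ℝ, E) x, g.IsHorizontal (F := F) f x w ∧
      mfderiv 𝓘(ℝ, E) 𝓘(ℝ, F) f x w = v := by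
  obtain ⟨u, rfl⟩ :=
    mfderiv_surjective_of_isSubmersionAt (by simp) (h.submersion.isSubmersionAt x) v
  exact g.exists_isHorizontal f x u

lemma inner_mfderiv_le (h : IsRiemannianSubmersion g b f) (x : M) (v : TangentSpace 𝓘(ℝ, E) x) :
    b.inner (f x) (mfderiv 𝓘(ℝ, E) 𝓘(ℝ, F) f x v) (mfderiv 𝓘(ℝ, E) 𝓘(ℝ, F) f x v) ≤
      g.inner x v v := by
  obtain ⟨w, hw, hwv⟩ := g.exists_isHorizontal (F := F) f x v
  have hvert : mfderiv 𝓘(ℝ, E) 𝓘(ℝ, F) f x (v - w) = 0 := by rw [map_sub, hwv, sub_self]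
  have horth : g.inner x (v - w) w = 0 := hw _ hvert
  have hpyth : g.inner x v v = g.inner x (v - w) (v - w) + g.inner x w w := by
    have hsymm := g.symm x w v
    simp only [map_sub, sub_apply] at horth ⊢
    linarith
  rw [← hwv, h.isometry x w w hw hw, hpyth]
  exact le_add_of_nonneg_left (g.inner_self_nonneg x (v - w))

lemma rdist_le [PreconnectedSpace M] (h : IsRiemannianSubmersion g b f) (x y : M) :
    b.rdist (f x) (f y) ≤ g.rdist x y := by
  simpa using RiemMetric.rdist_map_le (h.contMDiff.of_le (by simp)) zero_le_one
    (by simpa using h.inner_mfderiv_le) x y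

lemma exists_horizontal_curve_lift (h : IsRiemannianSubmersion g b f) {γ : ℝ → N} {t : ℝ}
    (hγ : ContMDiffAt 𝓘(ℝ, ℝ) 𝓘(ℝ, F) 1 γ t) {q : M} (hq : f q = γ t) :
    ∃ c : ℝ → M, c t = q ∧ ContMDiffAt 𝓘(ℝ, ℝ) 𝓘(ℝ, E) 1 c t ∧ (∀ᶠ s in 𝓝 t, f (c s) = γ s) ∧
      g.speed c t = b.speed γ t := by
  obtain ⟨u, hu, hfu⟩ := h.exists_isHorizontal_lift q (velocity γ t : F)
  obtain ⟨c, rfl, hc, hfc, hcu⟩ := exists_curve_lift_of_isSubmersionAt (by simp)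
    (h.submersion.isSubmersionAt q) hγ hq u hfu
  refine ⟨c, rfl, hc, hfc, congrArg Real.sqrt ?_⟩
  calc g.inner (c t) (velocity c t) (velocity c t)
      = g.inner (c t) u u := congrArg (fun w : E ↦ g.inner (c t) w w) hcu
    _ = b.inner (f (c t)) (mfderiv 𝓘(ℝ, E) 𝓘(ℝ, F) f (c t) u)
          (mfderiv 𝓘(ℝ, E) 𝓘(ℝ, F) f (c t) u) := (h.isometry (c t) u u hu hu).symm
    _ = b.inner (γ t) (velocity γ t) (velocity γ t) := b.inner_congr hq hfu hfu

lemma eventually_exists_lift (h : IsRiemannianSubmersion g b f) {γ : ℝ → N}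
    (hγ : ContMDiff 𝓘(ℝ, ℝ) 𝓘(ℝ, F) 1 γ) {k : ℝ → ℝ} (hk : Continuous k) {t : ℝ}
    (hγk : b.speed γ t < k t) {q : M} (hq : f q = γ t) :
    ∀ᶠ s in 𝓝[>] t, ∃ q', f q' = γ s ∧ g.rdist q q' ≤ ∫ τ in t..s, k τ := by
  obtain ⟨c, rfl, hc, hfc, hspeed⟩ := h.exists_horizontal_curve_lift hγ.contMDiffAt hq
  have hnear : ∀ᶠ s in 𝓝 t, f (c s) = γ s ∧ ContMDiffAt 𝓘(ℝ, ℝ) 𝓘(ℝ, E) 1 c s ∧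
      g.speed c s < k s :=
    hfc.and (((contMDiffAt_iff_contMDiffAt_nhds (by simp)).1 hc).and
      ((RiemMetric.continuousAt_speed hc).eventually_lt hk.continuousAt (hspeed ▸ hγk)))
  obtain ⟨t', ht', hsub⟩ := mem_nhdsGE_iff_exists_Icc_subset.1 (mem_nhdsWithin_of_mem_nhds hnear)
  filter_upwards [Ioc_mem_nhdsGT ht'] with s hs
  have hgood := fun τ (hτ : τ ∈ Icc t s) ↦ hsub ⟨hτ.1, hτ.2.trans hs.2⟩
  exact ⟨c s, (hgood s (right_mem_Icc.2 hs.1.le)).1,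
    RiemMetric.rdist_le_integral_of_speed_le hs.1.le
      (fun τ hτ ↦ (hgood τ hτ).2.1.contMDiffWithinAt) hk.continuousOn
      fun τ hτ ↦ (hgood τ hτ).2.2.le⟩

lemma exists_map_eq_rdist_le_integral [CompactSpace M] [PreconnectedSpace M] [T2Space N]
    (h : IsRiemannianSubmersion g b f) {γ : ℝ → N} (hγ : ContMDiff 𝓘(ℝ, ℝ) 𝓘(ℝ, F) 1 γ)
    {k : ℝ → ℝ} (hk : Continuous k) (hγk : ∀ t, b.speed γ t < k t) {t₀ t₁ : ℝ} (ht : t₀ ≤ t₁)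
    {x : M} (hx : f x = γ t₀) :
    ∃ x', f x' = γ t₁ ∧ g.rdist x x' ≤ ∫ t in t₀..t₁, k t := by
  have hint : ∀ s t, IntervalIntegrable k volume s t := fun s t ↦ hk.intervalIntegrable s t
  let S : Set ℝ := {t | ∃ q, f q = γ t ∧ g.rdist x q ≤ ∫ τ in t₀..t, k τ}
  have hS : IsClosed S := by
    have hclosed : IsClosed {p : M × ℝ | f p.1 = γ p.2 ∧ g.rdist x p.1 ≤ ∫ τ in t₀..p.2, k τ} :=
      (isClosed_eq (h.contMDiff.continuous.comp continuous_fst)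
        (hγ.continuous.comp continuous_snd)).inter
        (isClosed_le (g.continuous_rdist.comp (continuous_const.prodMk continuous_fst))
          ((intervalIntegral.continuous_primitive hint t₀).comp continuous_snd))
    convert isClosedMap_snd_of_compactSpace _ hclosed using 1
    ext t
    simp [S]
  refine (hS.inter isClosed_Icc).Icc_subset_of_forall_mem_nhdsWithin ⟨x, hx, by simp⟩ ?_
    (right_mem_Icc.2 ht)
  rintro t ⟨⟨q, hq, hxq⟩, -⟩
  filter_upwards [h.eventually_exists_lift hγ hk (hγk t) hq] with s ⟨q', hq', hqq'⟩
  refine ⟨q', hq', ?_⟩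
  rw [← intervalIntegral.integral_add_adjacent_intervals (hint t₀ t) (hint t s)]
  exact (g.rdist_triangle x q q').trans (add_le_add hxq hqq')

lemma exists_map_eq_rdist_lt [CompactSpace M] [PreconnectedSpace M] [T2Space N]
    [PreconnectedSpace N] (h : IsRiemannianSubmersion g b f) {x : M} {y : N} {r : ℝ}
    (hr : b.rdist (f x) y < r) : ∃ x', f x' = y ∧ g.rdist x x' < r := by
  obtain ⟨γ, h0, rfl, hγ, hlen⟩ := RiemMetric.exists_curve_integral_speed_lt hr
  obtain ⟨ε, hε, hlenε⟩ := exists_between (sub_pos.2 hlen)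
  have hspeed : Continuous (b.speed γ) := RiemMetric.continuous_speed hγ
  obtain ⟨x', hx', hxx'⟩ := h.exists_map_eq_rdist_le_integral hγ (hspeed.add_const ε)
    (fun t ↦ lt_add_of_pos_right _ hε) zero_le_one h0.symm
  refine ⟨x', hx', hxx'.trans_lt ?_⟩
  rw [intervalIntegral.integral_add (hspeed.intervalIntegrable _ _)
    intervalIntegrable_const]
  simpa using lt_sub_iff_add_lt'.1 hlenε

lemma abs_rdist_sub_rdist_le [CompactSpace M] [PreconnectedSpace M] [T2Space N]
    [PreconnectedSpace N] (h : IsRiemannianSubmersion g b f) {δ : ℝ}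
    (hδ : ∀ p q, f p = f q → g.rdist p q ≤ δ) (p q : M) :
    |g.rdist p q - b.rdist (f p) (f q)| ≤ δ := by
  have hupper : g.rdist p q ≤ b.rdist (f p) (f q) + δ := by
    refine le_of_forall_gt_imp_ge_of_dense fun r hr ↦ ?_
    obtain ⟨q', hq', hpq'⟩ := h.exists_map_eq_rdist_lt (lt_sub_iff_add_lt.2 hr)
    linarith [g.rdist_triangle p q' q, hδ q' q hq']
  rw [abs_of_nonneg (sub_nonneg.2 (h.rdist_le p q))]
  linarith

end IsRiemannianSubmersion

end RiemannianSubmersion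

/-! ### Smooth actions and invariant metrics -/

section Action

variable {𝕜 : Type*} [NontriviallyNormedField 𝕜]
  {E : Type*} [NormedAddCommGroup E] [NormedSpace 𝕜 E]
  {M : Type*} [TopologicalSpace M] [ChartedSpace E M]
  {F : Type*} [NormedAddCommGroup F] [NormedSpace 𝕜 F]
  {N : Type*} [TopologicalSpace N] [ChartedSpace F N]
  {G : Type*}

lemma mfderiv_inv_smul_mfderiv_smul [Group G] [MulAction G M]
    (hM : ∀ a : G, MDifferentiable 𝓘(𝕜, E) 𝓘(𝕜, E) (fun x : M ↦ a • x)) (a : G) (x : M)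
    (v : TangentSpace 𝓘(𝕜, E) x) :
    (mfderiv 𝓘(𝕜, E) 𝓘(𝕜, E) (fun y : M ↦ a⁻¹ • y) (a • x)
      (mfderiv 𝓘(𝕜, E) 𝓘(𝕜, E) (fun y : M ↦ a • y) x v) : E) = v := by
  have hcomp := mfderiv_comp x (hM a⁻¹ (a • x)) (hM a x)
  have hid : (fun y : M ↦ a⁻¹ • y) ∘ (fun y : M ↦ a • y) = id := funext (inv_smul_smul a)
  rw [hid, mfderiv_id] at hcomp
  exact (DFunLike.congr_fun hcomp v).symm

lemma mfderiv_smul_bijective [Group G] [MulAction G M]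
    (hM : ∀ a : G, MDifferentiable 𝓘(𝕜, E) 𝓘(𝕜, E) (fun x : M ↦ a • x)) (a : G) (x : M) :
    Function.Bijective (mfderiv 𝓘(𝕜, E) 𝓘(𝕜, E) (fun y : M ↦ a • y) x) := by
  refine ⟨fun v w hvw ↦ ?_, fun v ↦ ?_⟩
  · have hinv := congrArg (mfderiv 𝓘(𝕜, E) 𝓘(𝕜, E) (fun y : M ↦ a⁻¹ • y) (a • x)) hvw
    exact (mfderiv_inv_smul_mfderiv_smul hM a x v).symm.trans
      (Eq.trans hinv (mfderiv_inv_smul_mfderiv_smul hM a x w))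
  · have hinv := mfderiv_inv_smul_mfderiv_smul hM a⁻¹ (a • x) v
    rw [inv_inv, inv_smul_smul] at hinv
    exact ⟨_, hinv⟩

lemma mfderiv_mfderiv_smul [SMul G M] [SMul G N] {f : M → N} {a : G}
    (hfa : ∀ x, f (a • x) = a • f x) {x : M}
    (hM : MDifferentiableAt 𝓘(𝕜, E) 𝓘(𝕜, E) (fun y : M ↦ a • y) x)
    (hN : MDifferentiableAt 𝓘(𝕜, F) 𝓘(𝕜, F) (fun y : N ↦ a • y) (f x))
    (hf : MDifferentiable 𝓘(𝕜, E) 𝓘(𝕜, F) f) (v : TangentSpace 𝓘(𝕜, E) x) :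
    (mfderiv 𝓘(𝕜, E) 𝓘(𝕜, F) f (a • x)
      (mfderiv 𝓘(𝕜, E) 𝓘(𝕜, E) (fun y : M ↦ a • y) x v) : F) =
      mfderiv 𝓘(𝕜, F) 𝓘(𝕜, F) (fun y : N ↦ a • y) (f x) (mfderiv 𝓘(𝕜, E) 𝓘(𝕜, F) f x v) := by
  have hleft := mfderiv_comp x (hf (a • x)) hM
  have hcomm : f ∘ (fun y : M ↦ a • y) = (fun y : N ↦ a • y) ∘ f := funext hfa
  rw [hcomm] at hleft
  exact (DFunLike.congr_fun hleft v).symm.trans (DFunLike.congr_fun (mfderiv_comp x hN (hf x)) v)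

end Action

section Invariance

variable {E : Type*} [NormedAddCommGroup E] [NormedSpace ℝ E]
  {M : Type*} [TopologicalSpace M] [ChartedSpace E M] [IsManifold 𝓘(ℝ, E) ∞ M]
  {F : Type*} [NormedAddCommGroup F] [NormedSpace ℝ F]
  {N : Type*} [TopologicalSpace N] [ChartedSpace F N]
  {G : Type*} [Group G] [MulAction G M] {g : RiemMetric E M}

lemma RiemMetric.IsInvariant.of_tendsto {ι : Type*} {l : Filter ι} [l.NeBot]
    {b : ι → RiemMetric E M} {b' : RiemMetric E M} (hb : ∀ i, (b i).IsInvariant G)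
    (h : ∀ (x : M) (v w : TangentSpace 𝓘(ℝ, E) x),
      Tendsto (fun i ↦ (b i).inner x v w) l (𝓝 (b'.inner x v w))) : b'.IsInvariant G := by
  intro a x v w
  refine tendsto_nhds_unique (h _ _ _) ?_
  simpa only [hb _ a x v w] using h x v w

lemma RiemMetric.IsInvariant.rdist_smul [PreconnectedSpace M] (hg : g.IsInvariant G)
    (hM : ∀ a : G, ContMDiff 𝓘(ℝ, E) 𝓘(ℝ, E) 1 (fun x : M ↦ a • x)) (a : G) (x y : M) :
    g.rdist (a • x) (a • y) = g.rdist x y := by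
  have hle : ∀ (a : G) (x y : M), g.rdist (a • x) (a • y) ≤ g.rdist x y := fun a x y ↦ by
    simpa using RiemMetric.rdist_map_le (hM a) zero_le_one
      (fun x v ↦ by simpa using (hg a x v v).le) x y
  refine le_antisymm (hle a x y) ?_
  simpa using hle a⁻¹ (a • x) (a • y)

lemma RiemMetric.IsInvariant.rdist_lt_of_map_eq [PreconnectedSpace M] {X : Type*} [MulAction G X]
    [MulAction.IsPretransitive G X] {f : M → X} (hf : ∀ (a : G) (x : M), f (a • x) = a • f x)
    (hg : g.IsInvariant G) (hM : ∀ a : G, ContMDiff 𝓘(ℝ, E) 𝓘(ℝ, E) 1 (fun x : M ↦ a • x))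
    {x₀ : X} {δ : ℝ} (hδ : ∀ p q, f p = x₀ → f q = x₀ → g.rdist p q < δ) {p q : M}
    (hpq : f p = f q) : g.rdist p q < δ := by
  obtain ⟨a, ha⟩ := MulAction.exists_smul_eq G (f p) x₀
  rw [← hg.rdist_smul hM a]
  exact hδ _ _ ((hf a p).trans ha) ((hf a q).trans (hpq ▸ ha))

variable [MulAction G N] {f : M → N}

lemma RiemMetric.IsInvariant.isHorizontal_mfderiv_smul (hg : g.IsInvariant G)
    (hM : ∀ a : G, MDifferentiable 𝓘(ℝ, E) 𝓘(ℝ, E) (fun x : M ↦ a • x))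
    (hN : ∀ a : G, MDifferentiable 𝓘(ℝ, F) 𝓘(ℝ, F) (fun x : N ↦ a • x))
    (hf : ∀ (a : G) (x : M), f (a • x) = a • f x) (hfd : MDifferentiable 𝓘(ℝ, E) 𝓘(ℝ, F) f)
    (a : G) {x : M} {v : TangentSpace 𝓘(ℝ, E) x} (hv : g.IsHorizontal (F := F) f x v) :
    g.IsHorizontal (F := F) f (a • x)
      (mfderiv 𝓘(ℝ, E) 𝓘(ℝ, E) (fun y : M ↦ a • y) x v) := by
  intro u hu
  obtain ⟨u, rfl⟩ := (mfderiv_smul_bijective hM a x).2 u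
  refine (hg a x u v).trans (hv u ((mfderiv_smul_bijective hN a (f x)).1 ?_))
  exact ((mfderiv_mfderiv_smul (hf a) (hM a x) (hN a _) hfd u).symm.trans hu).trans
    (map_zero _).symm

variable [IsManifold 𝓘(ℝ, F) ∞ N] {b : RiemMetric F N}

namespace IsRiemannianSubmersion

lemma contMDiff_smul (h : IsRiemannianSubmersion g b f)
    (hM : ∀ a : G, ContMDiff 𝓘(ℝ, E) 𝓘(ℝ, E) ∞ (fun x : M ↦ a • x))
    (hf : ∀ (a : G) (x : M), f (a • x) = a • f x) (hsurj : Function.Surjective f) (a : G) :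
    ContMDiff 𝓘(ℝ, F) 𝓘(ℝ, F) ∞ (fun y : N ↦ a • y) := by
  refine contMDiff_of_comp_of_isSubmersion h.submersion hsurj ?_
  exact (h.contMDiff.comp (hM a)).congr fun x ↦ (hf a x).symm

lemma isInvariant [FiniteDimensional ℝ E] (h : IsRiemannianSubmersion g b f)
    (hg : g.IsInvariant G) (hM : ∀ a : G, ContMDiff 𝓘(ℝ, E) 𝓘(ℝ, E) ∞ (fun x : M ↦ a • x))
    (hf : ∀ (a : G) (x : M), f (a • x) = a • f x) (hsurj : Function.Surjective f) :
    b.IsInvariant G := by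
  have hfd : MDifferentiable 𝓘(ℝ, E) 𝓘(ℝ, F) f := h.contMDiff.mdifferentiable (by simp)
  have hMd := fun a ↦ (hM a).mdifferentiable (by simp)
  have hNd := fun a ↦ (h.contMDiff_smul hM hf hsurj a).mdifferentiable (by simp)
  intro a y v w
  obtain ⟨x, rfl⟩ := hsurj y
  have hcomm := fun u ↦ mfderiv_mfderiv_smul (hf a) (hMd a x) (hNd a (f x)) hfd u
  obtain ⟨v, hv, rfl⟩ := h.exists_isHorizontal_lift x v
  obtain ⟨w, hw, rfl⟩ := h.exists_isHorizontal_lift x w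
  calc _ = _ := b.inner_congr (hf a x).symm (hcomm v).symm (hcomm w).symm
    _ = _ := h.isometry (a • x) _ _ (hg.isHorizontal_mfderiv_smul hMd hNd hf hfd a hv)
      (hg.isHorizontal_mfderiv_smul hMd hNd hf hfd a hw)
    _ = g.inner x v w := hg a x v w
    _ = _ := (h.isometry x v w hv hw).symm

end IsRiemannianSubmersion

end Invariance

/-! ### Convergence of invariant metrics -/

section Convergence

lemma tendsto_clm_of_forall_tendsto_apply {𝕜 V W ι : Type*} [NontriviallyNormedField 𝕜]
    [CompleteSpace 𝕜] [NormedAddCommGroup V] [NormedSpace 𝕜 V] [FiniteDimensional 𝕜 V]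
    [NormedAddCommGroup W] [NormedSpace 𝕜 W] {l : Filter ι} {A : ι → V →L[𝕜] W} {A' : V →L[𝕜] W}
    (h : ∀ v, Tendsto (fun i ↦ A i v) l (𝓝 (A' v))) : Tendsto A l (𝓝 A') := by
  let e : (V →L[𝕜] W) ≃L[𝕜] Fin (Module.finrank 𝕜 V) → W :=
    ((ContinuousLinearEquiv.ofFinrankEq (Module.finrank_fin_fun 𝕜).symm).arrowCongr
      (1 : W ≃L[𝕜] W)).trans (ContinuousLinearEquiv.piRing _)
  rw [e.toHomeomorph.isInducing.tendsto_nhds_iff]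
  exact tendsto_pi_nhds.2 fun j ↦ h _

lemma eventually_norm_bilin_sub_le {𝕜 V W ι : Type*} [NontriviallyNormedField 𝕜]
    [CompleteSpace 𝕜] [NormedAddCommGroup V] [NormedSpace 𝕜 V] [FiniteDimensional 𝕜 V]
    [NormedAddCommGroup W] [NormedSpace 𝕜 W] {l : Filter ι} {B : ι → V →L[𝕜] V →L[𝕜] W}
    {B' : V →L[𝕜] V →L[𝕜] W} (h : ∀ v w, Tendsto (fun i ↦ B i v w) l (𝓝 (B' v w))) {δ : ℝ}
    (hδ : 0 < δ) : ∀ᶠ i in l, ∀ v w, ‖B i v w - B' v w‖ ≤ δ * ‖v‖ * ‖w‖ := by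
  have hB : Tendsto B l (𝓝 B') := tendsto_clm_of_forall_tendsto_apply fun v ↦
    tendsto_clm_of_forall_tendsto_apply (h v)
  have hnorm : Tendsto (fun i ↦ ‖B i - B'‖) l (𝓝 0) :=
    (tendsto_iff_norm_sub_tendsto_zero (E := V →L[𝕜] V →L[𝕜] W)).1 hB
  filter_upwards [hnorm.eventually_lt_const hδ] with i hi v w
  calc ‖B i v w - B' v w‖ ≤ ‖B i - B'‖ * ‖v‖ * ‖w‖ := (B i - B').le_opNorm₂ v w
    _ ≤ δ * ‖v‖ * ‖w‖ := by gcongr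

variable {F : Type*} [NormedAddCommGroup F] [NormedSpace ℝ F] [FiniteDimensional ℝ F]
  {N : Type*} [TopologicalSpace N] [ChartedSpace F N] [IsManifold 𝓘(ℝ, F) ∞ N]
  {ι : Type*} {l : Filter ι} {b : ι → RiemMetric F N} {b' : RiemMetric F N}

namespace RiemMetric

lemma eventually_inner_le_of_tendsto {y : N}
    (h : ∀ v w : TangentSpace 𝓘(ℝ, F) y,
      Tendsto (fun i ↦ (b i).inner y v w) l (𝓝 (b'.inner y v w))) {C : ℝ} (hC : 1 < C) :
    ∀ᶠ i in l, ∀ v : TangentSpace 𝓘(ℝ, F) y,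
      (b i).inner y v v ≤ C * b'.inner y v v ∧ b'.inner y v v ≤ C * (b i).inner y v v := by
  have hclose : ∀ᶠ i in l, ∀ v : TangentSpace 𝓘(ℝ, F) y,
      |(b i).inner y v v - b'.inner y v v| ≤ (1 - C⁻¹) * b'.inner y v v := by
    let := b'.riemannianBundle
    have : FiniteDimensional ℝ (TangentSpace 𝓘(ℝ, F) y) :=
      inferInstanceAs (FiniteDimensional ℝ F)
    filter_upwards [eventually_norm_bilin_sub_le (V := TangentSpace 𝓘(ℝ, F) y)
      h (sub_pos.2 (inv_lt_one_of_one_lt₀ hC))] with i hi v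
    have hv : b'.inner y v v = ‖v‖ * ‖v‖ := real_inner_self_eq_norm_mul_norm v
    exact (hi v v).trans_eq (by rw [hv, mul_assoc])
  filter_upwards [hclose] with i hi v
  obtain ⟨hlower, hupper⟩ := abs_le.1 (hi v)
  have hC0 : 0 < C := zero_lt_one.trans hC
  have hC1 : 1 - C⁻¹ ≤ C - 1 :=
    (Real.one_sub_inv_le_log_of_pos hC0).trans (Real.log_le_sub_one_of_pos hC0)
  constructor
  · linarith [mul_le_mul_of_nonneg_right hC1 (b'.inner_self_nonneg y v)]
  · rw [← inv_mul_le_iff₀ hC0]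
    linarith

lemma eventually_forall_inner_le {G : Type*} [Group G] [MulAction G N]
    [MulAction.IsPretransitive G N]
    (hN : ∀ a : G, MDifferentiable 𝓘(ℝ, F) 𝓘(ℝ, F) (fun x : N ↦ a • x))
    (hb : ∀ i, (b i).IsInvariant G) (hb' : b'.IsInvariant G) (y₀ : N)
    (h : ∀ v w : TangentSpace 𝓘(ℝ, F) y₀,
      Tendsto (fun i ↦ (b i).inner y₀ v w) l (𝓝 (b'.inner y₀ v w))) {C : ℝ} (hC : 1 < C) :
    ∀ᶠ i in l, ∀ (y : N) (v : TangentSpace 𝓘(ℝ, F) y),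
      (b i).inner y v v ≤ C * b'.inner y v v ∧ b'.inner y v v ≤ C * (b i).inner y v v := by
  filter_upwards [eventually_inner_le_of_tendsto h hC] with i hi y v
  obtain ⟨a, rfl⟩ := MulAction.exists_smul_eq G y₀ y
  obtain ⟨v, rfl⟩ := (mfderiv_smul_bijective hN a y₀).2 v
  rw [hb i a, hb' a]
  exact hi v

lemma eventually_abs_rdist_sub_le {G : Type*} [Group G] [MulAction G N]
    [MulAction.IsPretransitive G N] [CompactSpace N] [ConnectedSpace N]
    (hN : ∀ a : G, MDifferentiable 𝓘(ℝ, F) 𝓘(ℝ, F) (fun x : N ↦ a • x))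
    (hb : ∀ i, (b i).IsInvariant G)
    (h : ∀ (y : N) (v w : TangentSpace 𝓘(ℝ, F) y),
      Tendsto (fun i ↦ (b i).inner y v w) l (𝓝 (b'.inner y v w))) {ε : ℝ} (hε : 0 < ε) :
    ∀ᶠ i in l, ∀ x y, |(b i).rdist x y - b'.rdist x y| ≤ ε := by
  rcases l.eq_or_neBot with rfl | hl
  · exact eventually_bot
  obtain ⟨D, hD0, hD⟩ := b'.exists_forall_rdist_le
  obtain ⟨y₀⟩ : Nonempty N := inferInstance
  let η := ε / (D + 1)
  have hη : 0 < η := by positivity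
  have hηD : η * D ≤ ε := by
    calc η * D ≤ η * (D + 1) := by gcongr; linarith
      _ = ε := div_mul_cancel₀ ε (by positivity)
  filter_upwards [eventually_forall_inner_le hN hb (IsInvariant.of_tendsto hb h) y₀ (h y₀)
    (show 1 < (1 + η) ^ 2 by nlinarith)] with i hi x y
  have hle : (b i).rdist x y ≤ (1 + η) * b'.rdist x y :=
    rdist_map_le contMDiff_id (by positivity) (fun y v ↦ by simpa using (hi y v).1) x y
  have hge : b'.rdist x y ≤ (1 + η) * (b i).rdist x y :=
    rdist_map_le contMDiff_id (by positivity) (fun y v ↦ by simpa using (hi y v).2) x y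
  refine le_trans ?_ ((mul_le_mul_of_nonneg_left (hD x y) hη.le).trans hηD)
  rcases le_total (b'.rdist x y) ((b i).rdist x y) with hxy | hxy
  · rw [abs_of_nonneg (sub_nonneg.2 hxy)]
    linarith
  · rw [abs_of_nonpos (sub_nonpos.2 hxy)]
    linarith [mul_le_mul_of_nonneg_left hxy hη.le]

end RiemMetric

end Convergence

/-! ### Gromov–Hausdorff convergence along a surjection -/

section GromovHausdorff

lemma gromovHausdorffDist_le_of_surjective {A B : Type*} {dA : A → A → ℝ} {dB : B → B → ℝ}
    {f : A → B} (hf : Function.Surjective f) {ε : ℝ}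
    (h : ∀ p q, |dA p q - dB (f p) (f q)| < ε) :
    gromovHausdorffDist dA dB ≤ ENNReal.ofReal ε := by
  refine iInf₂_le ε ⟨{p | f p.1 = p.2}, fun a ↦ ⟨f a, rfl⟩, hf, fun p hp q hq ↦ ?_⟩
  rw [← show f p.1 = p.2 from hp, ← show f q.1 = q.2 from hq]
  exact h p.1 q.1

lemma lt_of_gromovHausdorffDist_unit_lt {A : Type*} {d : A → A → ℝ} {ε : ℝ}
    (h : gromovHausdorffDist d (fun _ _ : Unit ↦ (0 : ℝ)) < ENNReal.ofReal ε) (x y : A) :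
    d x y < ε := by
  obtain ⟨ε', ⟨S, hS⟩, hε⟩ := by simpa only [gromovHausdorffDist, iInf_lt_iff] using h
  obtain ⟨_, hx⟩ := hS.fst_onto x
  obtain ⟨_, hy⟩ := hS.fst_onto y
  have hxy : |d x y| < ε' := by simpa only [sub_zero] using hS.dist_lt _ hx _ hy
  exact ((le_abs_self _).trans_lt hxy).trans
    ((ENNReal.ofReal_lt_ofReal_iff_of_nonneg ((abs_nonneg _).trans hxy.le)).1 hε)

lemma tendsto_gromovHausdorffDist_zero {A B ι : Type*} {l : Filter ι} {dA : ι → A → A → ℝ}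
    {dB : ι → B → B → ℝ} {f : A → B} (hf : Function.Surjective f)
    (h : ∀ ε > 0, ∀ᶠ i in l, ∀ p q, |dA i p q - dB i (f p) (f q)| ≤ ε) :
    Tendsto (fun i ↦ gromovHausdorffDist (dA i) (dB i)) l (𝓝 0) := by
  refine ENNReal.tendsto_nhds_zero.2 fun ε hε ↦ ?_
  obtain ⟨δ, hδ, hδε⟩ := ENNReal.lt_iff_exists_nnreal_btwn.1 hε
  have hδ0 : (0 : ℝ) < δ := by simpa using hδ
  filter_upwards [h (δ / 2) (half_pos hδ0)] with i hi
  calc gromovHausdorffDist (dA i) (dB i)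
      ≤ ENNReal.ofReal δ :=
        gromovHausdorffDist_le_of_surjective hf fun p q ↦ (hi p q).trans_lt (half_lt_self hδ0)
    _ ≤ ε := by simpa using hδε.le

end GromovHausdorff

/-! ### Invariant submersion metrics with shrinking fibres -/

lemma surjective_of_map_smul {G X Y : Type*} [SMul G X] [SMul G Y] [MulAction.IsPretransitive G Y]
    [Nonempty X] {f : X → Y} (hf : ∀ (a : G) (x : X), f (a • x) = a • f x) :
    Function.Surjective f := by
  intro y
  obtain ⟨x⟩ := ‹Nonempty X›
  obtain ⟨a, ha⟩ := MulAction.exists_smul_eq G (f x) y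
  exact ⟨a • x, (hf a x).trans ha⟩

theorem mainTheorem11_general
    {G : Type*} [Group G]
    {E : Type*} [NormedAddCommGroup E] [NormedSpace ℝ E] [FiniteDimensional ℝ E]
    {M : Type*} [TopologicalSpace M] [ChartedSpace E M] [IsManifold 𝓘(ℝ, E) ∞ M]
    [CompactSpace M] [ConnectedSpace M] [MulAction G M]
    (hM : ∀ a : G, ContMDiff 𝓘(ℝ, E) 𝓘(ℝ, E) ∞ (fun x : M ↦ a • x))
    {F : Type*} [NormedAddCommGroup F] [NormedSpace ℝ F] [FiniteDimensional ℝ F]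
    {N : Type*} [TopologicalSpace N] [T2Space N] [ChartedSpace F N] [IsManifold 𝓘(ℝ, F) ∞ N]
    [MulAction G N] [MulAction.IsPretransitive G N]
    {f : M → N} (hf : ∀ (a : G) (x : M), f (a • x) = a • f x)
    {ι : Type*} {l : Filter ι} {g : ι → RiemMetric E M} (hg : ∀ i, (g i).IsInvariant G)
    (hsub : ∀ i, ∃ b : RiemMetric F N, IsRiemannianSubmersion (g i) b f)
    (y₀ : N)
    (hshrink : Tendsto (fun i ↦ gromovHausdorffDist
      (fun x y : f ⁻¹' {y₀} ↦ (g i).rdist (x : M) (y : M)) (fun _ _ : Unit ↦ (0 : ℝ))) l (𝓝 0)) :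
    ∃ b : ι → RiemMetric F N,
      (∀ i, (b i).IsInvariant G ∧ IsRiemannianSubmersion (g i) (b i) f) ∧
      Tendsto (fun i ↦ gromovHausdorffDist (g i).rdist (b i).rdist) l (𝓝 0) ∧
      ∀ b' : RiemMetric F N,
        (∀ (y : N) (v w : TangentSpace 𝓘(ℝ, F) y),
          Tendsto (fun i ↦ (b i).inner y v w) l (𝓝 (b'.inner y v w))) →
        Tendsto (fun i ↦ gromovHausdorffDist (g i).rdist b'.rdist) l (𝓝 0) := by
  have hsurj : Function.Surjective f := surjective_of_map_smul hf
  choose b hb using hsub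
  have hbinv : ∀ i, (b i).IsInvariant G := fun i ↦ (hb i).isInvariant (hg i) hM hf hsurj
  rcases l.eq_or_neBot with rfl | hl
  · exact ⟨b, fun i ↦ ⟨hbinv i, hb i⟩, tendsto_bot, fun _ _ ↦ tendsto_bot⟩
  obtain ⟨i₀⟩ := l.nonempty_of_neBot
  have : CompactSpace N := hsurj.compactSpace (hb i₀).contMDiff.continuous
  have : ConnectedSpace N := hsurj.connectedSpace (hb i₀).contMDiff.continuous
  have hclose : ∀ ε > 0, ∀ᶠ i in l, ∀ p q,
      |(g i).rdist p q - (b i).rdist (f p) (f q)| ≤ ε := by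
    intro ε hε
    filter_upwards [hshrink.eventually_lt_const (ENNReal.ofReal_pos.2 hε)] with i hi
    exact (hb i).abs_rdist_sub_rdist_le fun p q hpq ↦ ((hg i).rdist_lt_of_map_eq hf
      (fun a ↦ (hM a).of_le (by simp)) (fun p q hp hq ↦
        lt_of_gromovHausdorffDist_unit_lt hi ⟨p, hp⟩ ⟨q, hq⟩) hpq).le
  refine ⟨b, fun i ↦ ⟨hbinv i, hb i⟩, tendsto_gromovHausdorffDist_zero hsurj hclose,
    fun b' hb' ↦ tendsto_gromovHausdorffDist_zero hsurj fun ε hε ↦ ?_⟩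
  have hN := fun a ↦ ((hb i₀).contMDiff_smul hM hf hsurj a).mdifferentiable (by simp)
  filter_upwards [hclose (ε / 2) (half_pos hε),
    RiemMetric.eventually_abs_rdist_sub_le hN hbinv hb' (half_pos hε)] with i hgb hbb' p q
  linarith [abs_sub_le ((g i).rdist p q) ((b i).rdist (f p) (f q)) (b'.rdist (f p) (f q)),
    hgb p q, hbb' (f p) (f q)]

lemma cosetProj_smul {G : Type*} [Group G] {K H : Subgroup G} (hKH : K ≤ H) (a : G) (x : G ⧸ K) :
    cosetProj hKH (a • x) = a • cosetProj hKH x := by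
  obtain ⟨c, rfl⟩ := QuotientGroup.mk_surjective x
  rfl

lemma IsHomogeneousManifold.contMDiff_smul
    {E : Type*} [NormedAddCommGroup E] [NormedSpace ℝ E]
    {G : Type*} [TopologicalSpace G] [ChartedSpace E G] [Group G] [LieGroup 𝓘(ℝ, E) ∞ G]
    {K : Subgroup G} {EK : Type*} [NormedAddCommGroup EK] [NormedSpace ℝ EK]
    [ChartedSpace EK (G ⧸ K)] (hGK : IsHomogeneousManifold (E := E) K EK) (a : G) :
    ContMDiff 𝓘(ℝ, EK) 𝓘(ℝ, EK) ∞ (fun x : G ⧸ K ↦ a • x) :=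
  contMDiff_of_comp_of_isSubmersion hGK QuotientGroup.mk_surjective
    ((Manifold.IsSubmersion.contMDiff hGK).comp
      (contMDiff_mul_left (I := 𝓘(ℝ, E)) (n := ∞) (a := a)))

theorem mainTheorem11
    -- a Lie group `G` and closed subgroups `K ≤ H`
    {E : Type*} [NormedAddCommGroup E] [NormedSpace ℝ E] [FiniteDimensional ℝ E]
    {G : Type*} [TopologicalSpace G] [T2Space G] [SecondCountableTopology G]
    [ChartedSpace E G] [Group G] [LieGroup 𝓘(ℝ, E) ∞ G]
    (K H : Subgroup G) (hK : IsClosed (K : Set G)) (hH : IsClosed (H : Set G)) (hKH : K ≤ H)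
    -- the homogeneous spaces `G ⧸ K` and `G ⧸ H` with their smooth structures
    {EK : Type*} [NormedAddCommGroup EK] [NormedSpace ℝ EK] [FiniteDimensional ℝ EK]
    [ChartedSpace EK (G ⧸ K)] [IsManifold 𝓘(ℝ, EK) ∞ (G ⧸ K)]
    (hGK : IsHomogeneousManifold (E := E) K EK)
    {EH : Type*} [NormedAddCommGroup EH] [NormedSpace ℝ EH] [FiniteDimensional ℝ EH]
    [ChartedSpace EH (G ⧸ H)] [IsManifold 𝓘(ℝ, EH) ∞ (G ⧸ H)]
    (hGH : IsHomogeneousManifold (E := E) H EH)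
    [CompactSpace (G ⧸ K)] [ConnectedSpace (G ⧸ K)]
    -- every invariant metric on `G ⧸ K` is a submersion metric
    (hsub : ∀ g : RiemMetric EK (G ⧸ K), g.IsInvariant G →
      ∃ b : RiemMetric EH (G ⧸ H), IsRiemannianSubmersion g b (cosetProj hKH))
    -- a family of invariant metrics for which the fibre `H/K` shrinks to a point
    {ι : Type*} (l : Filter ι) (g : ι → RiemMetric EK (G ⧸ K))
    (hg : ∀ i, (g i).IsInvariant G)
    (hshrink : Tendsto (fun i ↦ gromovHausdorffDist
      (fun x y : cosetFibre hKH ↦ (g i).rdist (x : G ⧸ K) (y : G ⧸ K))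
      (fun _ _ : Unit ↦ (0 : ℝ))) l (𝓝 0)) :
    -- the induced base metrics
    ∃ b : ι → RiemMetric EH (G ⧸ H),
      (∀ i, (b i).IsInvariant G ∧ IsRiemannianSubmersion (g i) (b i) (cosetProj hKH)) ∧
      Tendsto (fun i ↦ gromovHausdorffDist (g i).rdist (b i).rdist) l (𝓝 0) ∧
      ∀ b' : RiemMetric EH (G ⧸ H),
        (∀ (y : G ⧸ H) (v w : TangentSpace 𝓘(ℝ, EH) y),
          Tendsto (fun i ↦ (b i).inner y v w) l (𝓝 (b'.inner y v w))) →
        Tendsto (fun i ↦ gromovHausdorffDist (g i).rdist b'.rdist) l (𝓝 0) := by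
  have : IsTopologicalGroup G := topologicalGroup_of_lieGroup 𝓘(ℝ, E) ∞
  exact mainTheorem11_general hGK.contMDiff_smul (cosetProj_smul hKH) hg
    (fun i ↦ hsub (g i) (hg i)) ((1 : G) : G ⧸ H) hshrink
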